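/- For a positive integer $n$, let $ex_{bip}(n, C_6, C_8)$ denote the maximum number of copies of the $6$-cycle $C_6$ (that is, of not necessarily induced subgraphs isomorphic to $C_6$) in a bipartite graph on $n$ vertices that contains no (not necessarily induced) subgraph isomorphic to the $8$-cycle $C_8$. Then, as $n \to \infty$, $$ex_{bip}(n, C_6, C_8) = n^3 + O(n^{5/2}).$$ -/

import Mathlib

/-- The bipartite generalized Turán number `ex_bip(n, H, F)`: the maximum number of copies of `H`
(that is, of subgraphs isomorphic to `H`) in a bipartite `F`-free graph on `n` vertices.
`F.Free G` says that `G` has no (not necessarily induced) subgraph isomorphic to `F`. -/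
noncomputable def exBip {W₁ W₂ : Type*} (n : ℕ) (H : SimpleGraph W₁) (F : SimpleGraph W₂) : ℕ :=
  open Classical in
  Finset.sup {G : SimpleGraph (Fin n) | G.IsBipartite ∧ F.Free G} fun G => G.copyCount H

/-- The supremum defining `exBip` is an attained maximum as soon as `F` has an edge. -/
theorem exBip_isGreatest {W₁ W₂ : Type*} (n : ℕ) (H : SimpleGraph W₁) (F : SimpleGraph W₂)
    (hF : F ≠ ⊥) :
    IsGreatest {m : ℕ | ∃ G : SimpleGraph (Fin n), G.IsBipartite ∧ F.Free G ∧ G.copyCount H = m}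
      (exBip n H F) := by
  classical
  constructor
  · have hne : (Finset.univ.filter
        fun G : SimpleGraph (Fin n) => G.IsBipartite ∧ F.Free G).Nonempty := by
      refine ⟨⊥, ?_⟩
      simp only [Finset.mem_filter, Finset.mem_univ, true_and]
      refine ⟨⟨SimpleGraph.Coloring.mk (fun _ => 0) (by simp)⟩, ?_⟩
      rintro ⟨f⟩
      apply hF
      ext u v
      simp only [SimpleGraph.bot_adj, iff_false]
      intro h
      exact f.toHom.map_adj h
    obtain ⟨G, hG, h⟩ := Finset.exists_mem_eq_sup _ hne
      (fun G : SimpleGraph (Fin n) => G.copyCount H)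
    simp only [Finset.mem_filter, Finset.mem_univ, true_and] at hG
    refine ⟨G, hG.1, hG.2, ?_⟩
    rw [exBip, ← h]
  · rintro m ⟨G, hG, hG', rfl⟩
    rw [exBip]
    refine Finset.le_sup (f := fun G : SimpleGraph (Fin n) => G.copyCount H) ?_
    simp only [Finset.mem_filter, Finset.mem_univ, true_and]
    exact ⟨hG, hG'⟩

/-! The main term comes from $K_{3,n-3}$: an eight-cycle would need four vertices on the side of
size three, and the labelled hexagons number $12(n-3)(n-4)(n-5)$. Since $C_6$ has 12 automorphisms,
everything is counted with labels and divided by 12.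

For the upper bound, call a pair fat if it has at least four common neighbours. Three consecutive
short diagonals of a hexagon cannot all be fat, since detours through common neighbours would give a
$C_8$ (`false_of_three_fat`). Hence either the three diagonals on one colour class are all fat, or
two opposite diagonals are both thin (`IsHexagon.fat_cases`). In the fat case the other three
vertices determine the fat triangle as a set (`mem_of_fat_triangles`), so each of the two colour
classes gives at most $6n^3$ labelled hexagons, in total $12n^3$, the sharp main term. In the thin
case the two edges not covered by the thin diagonals leave at most $3 \cdot 3$ choices for the two
remaining vertices, so the count is $O(e(G)^2)$.

It remains to show $e(G) = O(n^{5/4})$. In a subgraph of large minimum degree $K$, consecutive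
breadth-first levels span few edges (the three `false_of_common_*` lemmas), so levels grow by a
factor $K/8$ up to distance four, and $K^4 = O(n)$. -/

namespace SimpleGraph

/-! ### Labelled against unlabelled copies, and the automorphisms of the hexagon. -/

/-- The copies of `A` in `B` with image `S` are the isomorphisms from `A` to `S`. -/
noncomputable def Copy.isoEquivFiber {α β : Type*} {A : SimpleGraph α} {B : SimpleGraph β}
    (S : B.Subgraph) : (A ≃g S.coe) ≃ {f : Copy A B // f.toSubgraph = S} :=
  Equiv.ofBijective
    (fun e => ⟨⟨S.hom.comp e.toHom, Subgraph.hom_injective.comp e.injective⟩, by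
      simp [Copy.toSubgraph, Subgraph.map_comp]⟩) <| by
    constructor
    · intro e₁ e₂ h
      ext a
      have := congrArg (fun f : {f : Copy A B // f.toSubgraph = S} => f.1 a) h
      exact this
    · rintro ⟨f, rfl⟩
      refine ⟨f.isoToSubgraph, ?_⟩
      apply Subtype.ext
      ext a
      rfl

/-- Each unlabelled copy carries as many labellings as the pattern has automorphisms. -/
theorem labelledCopyCount_eq_card_aut_mul_copyCount {V W : Type*} [Fintype V] [Fintype W]
    (G : SimpleGraph V) (H : SimpleGraph W) :
    G.labelledCopyCount H = Nat.card (H ≃g H) * G.copyCount H := by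
  classical
  rw [labelledCopyCount, ← Finset.card_univ, copyCount_eq_card_image_copyToSubgraph]
  rw [Finset.card_eq_sum_card_image Copy.toSubgraph, mul_comm, ← smul_eq_mul,
    ← Finset.sum_const]
  refine Finset.sum_congr rfl fun S hS => ?_
  obtain ⟨f, -, rfl⟩ := Finset.mem_image.1 hS
  have e := f.isoToSubgraph
  have h₁ : (H ≃g H) ≃ (H ≃g f.toSubgraph.coe) :=
    ⟨fun g => g.trans e, fun g => g.trans e.symm, fun g => by ext; simp, fun g => by ext; simp⟩
  rw [Nat.card_congr (h₁.trans (Copy.isoEquivFiber _)), Nat.card_eq_fintype_card,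
    Fintype.card_subtype]

/-- Each vertex has only two neighbours, one on either side, so a walk that does not turn back
repeats its last step. -/
theorem cycleGraph_six_next : ∀ a b c : Fin 6, (cycleGraph 6).Adj a b → (cycleGraph 6).Adj b c →
    a ≠ c → c = b + (b - a) := by decide

/-- An automorphism of the hexagon is determined by the image of a dart. -/
theorem cycleGraph_six_iso_apply (f : cycleGraph 6 ≃g cycleGraph 6) (i : Fin 6) :
    f i = f 0 + i * (f 1 - f 0) := by
  have step (a b c : Fin 6) (hab : (cycleGraph 6).Adj a b) (hbc : (cycleGraph 6).Adj b c)
      (hac : a ≠ c) : f c = f b + (f b - f a) :=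
    cycleGraph_six_next _ _ _ (f.map_adj_iff.2 hab) (f.map_adj_iff.2 hbc) (f.injective.ne hac)
  have h2 := step 0 1 2 (by decide) (by decide) (by decide)
  have h3 := step 1 2 3 (by decide) (by decide) (by decide)
  have h4 := step 2 3 4 (by decide) (by decide) (by decide)
  have h5 := step 3 4 5 (by decide) (by decide) (by decide)
  have key : ∀ p q : Fin 6, ∀ i : Fin 6,
    (![p, q, q + (q - p), q + (q - p) + (q + (q - p) - q),
      p + 4 * (q - p), p + 5 * (q - p)] : Fin 6 → Fin 6) i = p + i * (q - p) := by decide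
  have k3 := key (f 0) (f 1) 3
  have k2 := key (f 0) (f 1) 2
  have e4 : ∀ p q : Fin 6, p + 3 * (q - p) + (p + 3 * (q - p) - (p + 2 * (q - p))) =
    p + 4 * (q - p) := by decide
  have e5 : ∀ p q : Fin 6, p + 4 * (q - p) + (p + 4 * (q - p) - (p + 3 * (q - p))) =
    p + 5 * (q - p) := by decide
  simp only [Matrix.cons_val] at k2 k3
  rw [k2] at h2
  rw [h2, ← k2, k3] at h3
  rw [h3, h2, e4] at h4
  rw [h4, h3, e5] at h5
  fin_cases i
  · simp
  · simp
  · exact h2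
  · exact h3
  · exact h4
  · exact h5

/-- Automorphisms correspond to darts, by taking the image of the dart $(0,1)$, and the hexagon has
12 darts. -/
theorem card_aut_cycleGraph_six : Nat.card (cycleGraph 6 ≃g cycleGraph 6) = 12 := by
  have inj : ∀ p q : Fin 6, (cycleGraph 6).Adj p q → ∀ i j : Fin 6,
    p + i * (q - p) = p + j * (q - p) → i = j := by decide
  have adj : ∀ p q : Fin 6, (cycleGraph 6).Adj p q → ∀ i j : Fin 6,
    ((cycleGraph 6).Adj (p + i * (q - p)) (p + j * (q - p)) ↔ (cycleGraph 6).Adj i j) := by decide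
  have e : (cycleGraph 6 ≃g cycleGraph 6) ≃
      {p : Fin 6 × Fin 6 // (cycleGraph 6).Adj p.1 p.2} := by
    refine Equiv.ofBijective
      (fun f => ⟨(f 0, f 1), f.map_adj_iff.2 (by decide)⟩) ⟨?_, ?_⟩
    · intro f g h
      have h0 : f 0 = g 0 := congrArg (fun p => p.1.1) h
      have h1 : f 1 = g 1 := congrArg (fun p => p.1.2) h
      ext i : 1
      rw [cycleGraph_six_iso_apply f, cycleGraph_six_iso_apply g, h0, h1]
    · rintro ⟨⟨p, q⟩, h⟩
      refine ⟨⟨Equiv.ofBijective (fun i => p + i * (q - p))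
        (Finite.injective_iff_bijective.1 fun i j => inj p q h i j), ?_⟩, ?_⟩
      · intro i j
        exact adj p q h i j
      · apply Subtype.ext
        exact Prod.ext (by change p + 0 * (q - p) = p; simp) (by change p + 1 * (q - p) = q; simp)
  rw [Nat.card_congr e, Nat.card_eq_fintype_card]
  decide

/-! ### Finding eight-cycles in dense pieces between breadth-first levels. -/

variable {V : Type*} {G : SimpleGraph V}

/-- In a graph with a proper two-colouring and no eight-cycle there is no closed walk of length
eight whose even-indexed and odd-indexed vertices are respectively distinct. -/
theorem false_of_eight_cycle (hG : G.IsBipartite) (h8 : (cycleGraph 8).Free G)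
    {a₁ b₁ a₂ b₂ a₃ b₃ a₄ b₄ : V}
    (h₁ : G.Adj a₁ b₁) (h₂ : G.Adj b₁ a₂) (h₃ : G.Adj a₂ b₂) (h₄ : G.Adj b₂ a₃)
    (h₅ : G.Adj a₃ b₃) (h₆ : G.Adj b₃ a₄) (h₇ : G.Adj a₄ b₄) (h₈ : G.Adj b₄ a₁)
    (a12 : a₁ ≠ a₂) (a13 : a₁ ≠ a₃) (a14 : a₁ ≠ a₄) (a23 : a₂ ≠ a₃) (a24 : a₂ ≠ a₄)
    (a34 : a₃ ≠ a₄)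
    (b12 : b₁ ≠ b₂) (b13 : b₁ ≠ b₃) (b14 : b₁ ≠ b₄) (b23 : b₂ ≠ b₃) (b24 : b₂ ≠ b₄)
    (b34 : b₃ ≠ b₄) : False := by
  obtain ⟨c⟩ := hG
  have flip {u v : V} (h : G.Adj u v) : (c u = 0 ∧ c v = 1) ∨ (c u = 1 ∧ c v = 0) := by
    have := c.valid h
    revert this
    generalize c u = x
    generalize c v = y
    revert x y
    decide
  have ne {u v : V} (h : c u ≠ c v) : u ≠ v := fun h' => h (congrArg c h')
  have k₁ := flip h₁
  have k₂ := flip h₂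
  have k₃ := flip h₃
  have k₄ := flip h₄
  have k₅ := flip h₅
  have k₆ := flip h₆
  have k₇ := flip h₇
  have hnd : [a₁, b₁, a₂, b₂, a₃, b₃, a₄, b₄].Nodup := by
    -- Colours alternate along the walk, so an $a$ never equals a $b$.
    have : (c a₁ = 0 ∧ c b₁ = 1 ∧ c a₂ = 0 ∧ c b₂ = 1 ∧ c a₃ = 0 ∧ c b₃ = 1 ∧ c a₄ = 0 ∧ c b₄ = 1)
        ∨ (c a₁ = 1 ∧ c b₁ = 0 ∧ c a₂ = 1 ∧ c b₂ = 0 ∧ c a₃ = 1 ∧ c b₃ = 0 ∧ c a₄ = 1 ∧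
          c b₄ = 0) := by
      rcases k₁ with k₁ | k₁ <;> simp_all
    simp only [List.nodup_cons, List.mem_cons, List.not_mem_nil, not_or, not_false_eq_true,
      or_false, List.nodup_nil, and_true]
    refine ⟨⟨?_, ?_, ?_, ?_, ?_, ?_, ?_⟩, ⟨?_, ?_, ?_, ?_, ?_, ?_⟩, ⟨?_, ?_, ?_, ?_, ?_⟩,
      ⟨?_, ?_, ?_, ?_⟩, ⟨?_, ?_, ?_⟩, ⟨?_, ?_⟩, ?_⟩ <;>
    first
    | assumption
    | (apply ne; rcases this with h | h <;> simp [h])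
  let f : Fin 8 → V := [a₁, b₁, a₂, b₂, a₃, b₃, a₄, b₄].get
  have hf : Function.Injective f := List.nodup_iff_injective_get.1 hnd
  have hadj : ∀ i : Fin 8, G.Adj (f i) (f (i + 1)) := by
    intro i
    fin_cases i <;> assumption
  refine h8 ⟨⟨f, ?_⟩, hf⟩
  intro i j hij
  rw [cycleGraph_adj] at hij
  rcases hij with h | h
  · rw [sub_eq_iff_eq_add'.1 h]
    exact (hadj j).symm
  · rw [sub_eq_iff_eq_add'.1 h]
    exact hadj i

end SimpleGraph

open scoped Classical in
/-- A symmetric relation with many related pairs inside `S` has a nonempty restriction of large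
minimum degree. -/
theorem Finset.exists_subset_forall_lt_card_rel {V : Type*} {R : V → V → Prop}
    (hR : ∀ u v, R u v → R v u) (K : ℕ) (S : Finset V)
    (h : 2 * K * S.card < ∑ v ∈ S, (S.filter (R v)).card) :
    ∃ T ⊆ S, T.Nonempty ∧ ∀ v ∈ T, K < (T.filter (R v)).card := by
  induction S using Finset.strongInduction with
  | H S ih =>
    by_cases hS : ∀ v ∈ S, K < (S.filter (R v)).card
    · refine ⟨S, Finset.Subset.refl _, ?_, hS⟩
      rw [Finset.nonempty_iff_ne_empty]
      rintro rfl
      simp at h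
    -- Deleting a vertex with at most `K` partners destroys at most `2 * K` ordered pairs, so the
    -- density hypothesis survives.
    · push Not at hS
      obtain ⟨v, hv, hK⟩ := hS
      have hsplit (u : V) : (S.filter (R u)).card ≤
          ((S.erase v).filter (R u)).card + if R v u then 1 else 0 := by
        rw [← Finset.insert_erase hv, Finset.filter_insert, Finset.erase_insert_eq_erase]
        split_ifs with h₁ h₂ h₂
        · exact (Finset.card_insert_le _ _).trans (by simp)
        · exact absurd (hR _ _ h₁) h₂
        · simp
        · simp
      have hsum : ∑ u ∈ S, (S.filter (R u)).card ≤
          (∑ u ∈ S.erase v, ((S.erase v).filter (R u)).card) + 2 * K := by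
        rw [← Finset.add_sum_erase S _ hv]
        have h₁ : ∑ u ∈ S.erase v, (S.filter (R u)).card ≤
            ∑ u ∈ S.erase v, ((S.erase v).filter (R u)).card +
              ∑ u ∈ S.erase v, if R v u then 1 else 0 := by
          rw [← Finset.sum_add_distrib]
          exact Finset.sum_le_sum fun u _ => hsplit u
        have h₂ : (∑ u ∈ S.erase v, if R v u then 1 else 0) ≤ (S.filter (R v)).card := by
          rw [← Finset.card_filter]
          exact Finset.card_le_card (Finset.filter_subset_filter _ (Finset.erase_subset _ _))
        omega
      have hcard := Finset.card_erase_add_one hv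
      obtain ⟨T, hT, hne, hd⟩ := ih (S.erase v) (Finset.erase_ssubset hv) (by
        rw [← hcard] at h
        rw [mul_add] at h
        omega)
      exact ⟨T, hT.trans (Finset.erase_subset _ _), hne, hd⟩

namespace SimpleGraph

variable {V : Type*} {G : SimpleGraph V}

open scoped Classical in
/-- Every vertex of `X` has more than four neighbours in `Y` and vice versa. -/
def FourLtDegreesBetween (G : SimpleGraph V) (X Y : Finset V) : Prop :=
  (∀ x ∈ X, 4 < (Y.filter (G.Adj x)).card) ∧ ∀ y ∈ Y, 4 < (X.filter (G.Adj y)).card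

-- Only edges between `X` and `Y` are kept in the relation `R`. Each gives two ordered pairs, so the
-- deletion argument applies with bound 4.
open scoped Classical in
theorem exists_fourLtDegreesBetween {X Y : Finset V} (hXY : Disjoint X Y)
    (h : 4 * (X.card + Y.card) < ∑ x ∈ X, (Y.filter (G.Adj x)).card) :
    ∃ X' ⊆ X, ∃ Y' ⊆ Y, X'.Nonempty ∧ G.FourLtDegreesBetween X' Y' := by
  obtain ⟨R, hR'⟩ : ∃ R : V → V → Prop,
      ∀ u v, R u v ↔ G.Adj u v ∧ (u ∈ X ∧ v ∈ Y ∨ u ∈ Y ∧ v ∈ X) := ⟨_, fun _ _ => Iff.rfl⟩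
  have hR (u v : V) : R u v → R v u := by
    rw [hR', hR', G.adj_comm]
    tauto
  have hdc : ∑ y ∈ Y, (X.filter (G.Adj y)).card = ∑ x ∈ X, (Y.filter (G.Adj x)).card := by
    have := Finset.sum_card_bipartiteAbove_eq_sum_card_bipartiteBelow G.Adj (s := X) (t := Y)
    simp only [Finset.bipartiteAbove, Finset.bipartiteBelow] at this
    rw [this]
    simp only [G.adj_comm]
  have hX {x : V} (hx : x ∈ X) : x ∉ Y := Finset.disjoint_left.1 hXY hx
  have hY {y : V} (hy : y ∈ Y) : y ∉ X := Finset.disjoint_right.1 hXY hy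
  obtain ⟨T, hT, ⟨t, ht⟩, hd⟩ := Finset.exists_subset_forall_lt_card_rel hR 4 (X ∪ Y) (by
    rw [Finset.card_union_of_disjoint hXY, Finset.sum_union hXY]
    have h₁ : ∑ x ∈ X, (Y.filter (G.Adj x)).card ≤
        ∑ x ∈ X, ((X ∪ Y).filter (R x)).card := by
      refine Finset.sum_le_sum fun x hx => Finset.card_le_card fun y hy => ?_
      rw [Finset.mem_filter] at hy ⊢
      exact ⟨Finset.mem_union_right _ hy.1, (hR' _ _).2 ⟨hy.2, Or.inl ⟨hx, hy.1⟩⟩⟩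
    have h₂ : ∑ y ∈ Y, (X.filter (G.Adj y)).card ≤
        ∑ y ∈ Y, ((X ∪ Y).filter (R y)).card := by
      refine Finset.sum_le_sum fun x hx => Finset.card_le_card fun y hy => ?_
      rw [Finset.mem_filter] at hy ⊢
      exact ⟨Finset.mem_union_left _ hy.1, (hR' _ _).2 ⟨hy.2, Or.inr ⟨hx, hy.1⟩⟩⟩
    omega)
  have hdX : ∀ x ∈ T ∩ X, 4 < ((T ∩ Y).filter (G.Adj x)).card := by
    intro x hx
    rw [Finset.mem_inter] at hx
    refine (hd x hx.1).trans_le (Finset.card_le_card fun y hy => ?_)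
    rw [Finset.mem_filter] at hy ⊢
    rw [hR'] at hy
    obtain ⟨hy, hxy, h⟩ := hy
    have := hX hx.2
    exact ⟨Finset.mem_inter.2 ⟨hy, by tauto⟩, hxy⟩
  have hdY : ∀ y ∈ T ∩ Y, 4 < ((T ∩ X).filter (G.Adj y)).card := by
    intro x hx
    rw [Finset.mem_inter] at hx
    refine (hd x hx.1).trans_le (Finset.card_le_card fun y hy => ?_)
    rw [Finset.mem_filter] at hy ⊢
    rw [hR'] at hy
    obtain ⟨hy, hxy, h⟩ := hy
    have := hY hx.2
    exact ⟨Finset.mem_inter.2 ⟨hy, by tauto⟩, hxy⟩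
  refine ⟨T ∩ X, Finset.inter_subset_right, T ∩ Y, Finset.inter_subset_right, ?_, hdX, hdY⟩
  rcases Finset.mem_union.1 (hT ht) with h | h
  · exact ⟨t, Finset.mem_inter.2 ⟨ht, h⟩⟩
  · obtain ⟨x, hx⟩ := Finset.card_pos.1 ((Nat.zero_le _).trans_lt (hdY t
      (Finset.mem_inter.2 ⟨ht, h⟩)))
    exact ⟨x, (Finset.mem_filter.1 hx).1⟩

namespace FourLtDegreesBetween

variable {X Y : Finset V}

theorem symm (h : G.FourLtDegreesBetween X Y) : G.FourLtDegreesBetween Y X := ⟨h.2, h.1⟩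

/-- A vertex of `X` has a neighbour in `Y` avoiding up to four prescribed vertices. -/
theorem exists_adj (h : G.FourLtDegreesBetween X Y) {x : V} (hx : x ∈ X) (a b c d : V) :
    ∃ y ∈ Y, G.Adj x y ∧ y ≠ a ∧ y ≠ b ∧ y ≠ c ∧ y ≠ d := by
  classical
  have : (({a, b, c, d} : Finset V)).card < (Y.filter (G.Adj x)).card :=
    Finset.card_le_four.trans_lt (by convert! h.1 x hx)
  obtain ⟨y, hy, hn⟩ := Finset.exists_mem_notMem_of_card_lt_card this
  rw [Finset.mem_filter] at hy
  simp only [Finset.mem_insert, Finset.mem_singleton, not_or] at hn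
  exact ⟨y, hy.1, hy.2, hn⟩

/-- Restricting to one value of a labelling that is constant on the neighbourhoods of the vertices
of `Y` keeps the degrees. -/
theorem exists_restrict {ι : Type*} (h : G.FourLtDegreesBetween X Y) (f : V → ι)
    (hf : ∀ y ∈ Y, ∀ x ∈ X, ∀ x' ∈ X, G.Adj y x → G.Adj y x' → f x = f x') {x₀ : V}
    (hx₀ : x₀ ∈ X) :
    ∃ X' ⊆ X, ∃ Y' ⊆ Y, X'.Nonempty ∧ G.FourLtDegreesBetween X' Y' ∧ ∀ x ∈ X', f x = f x₀ := by
  classical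
  refine ⟨X.filter fun x => f x = f x₀, Finset.filter_subset _ _,
    Y.filter fun y => ∃ x ∈ X, f x = f x₀ ∧ G.Adj y x, Finset.filter_subset _ _,
    ⟨x₀, by simp [hx₀]⟩, ⟨?_, ?_⟩, by simp⟩
  · intro x hx
    rw [Finset.mem_filter] at hx
    refine (h.1 x hx.1).trans_le (Finset.card_le_card fun y hy => ?_)
    rw [Finset.mem_filter] at hy ⊢
    exact ⟨Finset.mem_filter.2 ⟨hy.1, x, hx.1, hx.2, hy.2.symm⟩, hy.2⟩
  · intro y hy
    rw [Finset.mem_filter] at hy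
    obtain ⟨hy, x, hx, hfx, hyx⟩ := hy
    refine (h.2 y hy).trans_le (Finset.card_le_card fun x' hx' => ?_)
    rw [Finset.mem_filter] at hx' ⊢
    exact ⟨Finset.mem_filter.2 ⟨hx'.1, (hf y hy x' hx'.1 x hx hx'.2 hyx).trans hfx⟩, hx'.2⟩

variable (hG : G.IsBipartite) (h8 : (cycleGraph 8).Free G)
include hG h8

/-- A greedy path $x_0y_0x_1y_1x_2y_2x_3$ closes up through `p` to an eight-cycle. -/
theorem false_of_common_parent (h : G.FourLtDegreesBetween X Y) (hX : X.Nonempty) {p : V}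
    (hp : ∀ x ∈ X, G.Adj p x) (hpY : p ∉ Y) : False := by
  obtain ⟨x₀, hx₀⟩ := hX
  obtain ⟨y₀, hy₀, e₀, -⟩ := h.exists_adj hx₀ x₀ x₀ x₀ x₀
  obtain ⟨x₁, hx₁, e₁, n₁, -⟩ := h.symm.exists_adj hy₀ x₀ x₀ x₀ x₀
  obtain ⟨y₁, hy₁, e₂, n₂, -⟩ := h.exists_adj hx₁ y₀ y₀ y₀ y₀
  obtain ⟨x₂, hx₂, e₃, n₃, n₄, -⟩ := h.symm.exists_adj hy₁ x₀ x₁ x₁ x₁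
  obtain ⟨y₂, hy₂, e₄, n₅, n₆, -⟩ := h.exists_adj hx₂ y₀ y₁ y₁ y₁
  obtain ⟨x₃, hx₃, e₅, n₇, n₈, n₉, -⟩ := h.symm.exists_adj hy₂ x₀ x₁ x₂ x₂
  have hne {y : V} (hy : y ∈ Y) : p ≠ y := by rintro rfl; exact hpY hy
  exact false_of_eight_cycle hG h8 (hp _ hx₀) e₀ e₁ e₂ e₃ e₄ e₅ (hp _ hx₃).symm
    (hne hy₀) (hne hy₁) (hne hy₂) n₂.symm n₅.symm n₆.symm n₁.symm n₃.symm n₇.symm n₄.symm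
    n₈.symm n₉.symm

/-- A path $z\,y\,x_1y_1x_2$ closes up through the parents of its ends and `g` unless these parents
coincide. Applied to two neighbours `z` of the same `y` with a common far end $x_2$, this makes the
parent constant on neighbourhoods, so one may restrict to a single parent. -/
theorem false_of_common_grandparent (h : G.FourLtDegreesBetween X Y) (hX : X.Nonempty)
    {par : V → V} {g : V} (hpar : ∀ x ∈ X, G.Adj (par x) x) (hg : ∀ x ∈ X, G.Adj g (par x))
    (hpY : ∀ x ∈ X, par x ∉ Y) (hgX : g ∉ X) : False := by
  have hne {x y : V} (hx : x ∈ X) (hy : y ∈ Y) : par x ≠ y := by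
    rintro rfl; exact hpY x hx hy
  have hgne {x : V} (hx : x ∈ X) : g ≠ x := by rintro rfl; exact hgX hx
  have hconst : ∀ y ∈ Y, ∀ x ∈ X, ∀ x' ∈ X, G.Adj y x → G.Adj y x' → par x = par x' := by
    intro y hy x hx x' hx' e e'
    by_contra hcon
    obtain ⟨x₁, hx₁, e₁, n₁, n₁', -⟩ := h.symm.exists_adj hy x x' x x
    obtain ⟨y₁, hy₁, e₂, n₂, -⟩ := h.exists_adj hx₁ y y y y
    obtain ⟨x₂, hx₂, e₃, n₃, n₃', n₄, -⟩ := h.symm.exists_adj hy₁ x x' x₁ x₁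
    have key {z : V} (hz : z ∈ X) (ez : G.Adj y z) (hz₁ : x₁ ≠ z) (hz₂ : x₂ ≠ z) :
        par x₂ = par z := by
      by_contra hn
      exact false_of_eight_cycle hG h8 (hg z hz) (hpar z hz) ez.symm e₁ e₂ e₃ (hpar _ hx₂).symm
        (hg _ hx₂).symm (hgne hz) (hgne hx₁) (hgne hx₂) hz₁.symm hz₂.symm n₄.symm
        (hne hz hy) (hne hz hy₁) (Ne.symm hn) n₂.symm (hne hx₂ hy).symm (hne hx₂ hy₁).symm
    exact hcon ((key hx e n₁ n₃).symm.trans (key hx' e' n₁' n₃'))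
  obtain ⟨x₀, hx₀⟩ := hX
  obtain ⟨X', hX', Y', hY', hne', hd, hc⟩ := h.exists_restrict par hconst hx₀
  exact hd.false_of_common_parent hG h8 hne' (p := par x₀)
    (fun x hx => hc x hx ▸ hpar x (hX' hx)) fun hp => hpY x₀ hx₀ (hY' hp)

/-- Two neighbours of the same `y` with different grandparents close up through `r` to an
eight-cycle, so one may restrict to a single grandparent. -/
theorem false_of_common_root (h : G.FourLtDegreesBetween X Y) (hX : X.Nonempty)
    {par gpar : V → V} {r : V} (hpar : ∀ x ∈ X, G.Adj (par x) x)
    (hgpar : ∀ x ∈ X, G.Adj (gpar (par x)) (par x)) (hr : ∀ x ∈ X, G.Adj r (gpar (par x)))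
    (hpY : ∀ x ∈ X, par x ∉ Y) (hgX : ∀ x ∈ X, gpar (par x) ∉ X)
    (hrp : ∀ x ∈ X, r ≠ par x) (hrY : r ∉ Y) : False := by
  have hne {x y : V} (hx : x ∈ X) (hy : y ∈ Y) : par x ≠ y := by
    rintro rfl; exact hpY x hx hy
  have hgne {x x' : V} (hx : x ∈ X) (hx' : x' ∈ X) : gpar (par x) ≠ x' := by
    rintro rfl; exact hgX x hx hx'
  have hrne {y : V} (hy : y ∈ Y) : r ≠ y := by rintro rfl; exact hrY hy
  have hconst : ∀ y ∈ Y, ∀ x ∈ X, ∀ x' ∈ X, G.Adj y x → G.Adj y x' →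
      gpar (par x) = gpar (par x') := by
    intro y hy x hx x' hx' e e'
    by_contra hcon
    have hp : par x ≠ par x' := fun h => hcon (congrArg gpar h)
    have hxx : x ≠ x' := fun h => hp (congrArg par h)
    exact false_of_eight_cycle hG h8 (hr x hx) (hgpar x hx) (hpar x hx) e.symm e'
      (hpar x' hx').symm (hgpar x' hx').symm (hr x' hx').symm
      (hrp x hx) (hrne hy) (hrp x' hx') (hne hx hy) hp (hne hx' hy).symm
      (hgne hx hx) (hgne hx hx') hcon hxx (hgne hx' hx).symm (hgne hx' hx').symm
  obtain ⟨x₀, hx₀⟩ := hX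
  obtain ⟨X', hX', Y', hY', hne', hd, hc⟩ :=
    h.exists_restrict (fun x => gpar (par x)) hconst hx₀
  exact hd.false_of_common_grandparent hG h8 hne' (par := par) (g := gpar (par x₀))
    (fun x hx => hpar x (hX' hx)) (fun x hx => hc x hx ▸ hgpar x (hX' hx))
    (fun x hx hp => hpY x (hX' hx) (hY' hp)) fun hg => hgX x₀ hx₀ (hX' hg)

end FourLtDegreesBetween

end SimpleGraph

/-! ### Growth of the levels and the edge bound. -/

namespace SimpleGraph

open scoped Classical in
/-- A bipartite graph without eight-cycles and with minimum degree `K ≥ 24` has at least `K⁴/512`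
vertices. -/
theorem pow_four_le_of_le_degree {V : Type*} [Fintype V] [Nonempty V] {G : SimpleGraph V}
    (hG : G.IsBipartite) (h8 : (cycleGraph 8).Free G) {K : ℕ} (hK : 24 ≤ K)
    (hdeg : ∀ v, K ≤ G.degree v) : K ^ 4 ≤ 512 * Fintype.card V := by
  obtain ⟨r⟩ := ‹Nonempty V›
  obtain ⟨c⟩ := id hG
  -- These are the spheres of radius 1 to 4 about `r`: colours separate levels of different parity,
  -- so only the level two steps back has to be excluded.
  obtain ⟨L₁, hL₁⟩ : ∃ L : Finset V, ∀ v, v ∈ L ↔ G.Adj r v := ⟨G.neighborFinset r, by simp⟩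
  obtain ⟨L₂, hL₂⟩ : ∃ L : Finset V, ∀ v, v ∈ L ↔ (∃ u ∈ L₁, G.Adj u v) ∧ v ≠ r :=
    ⟨Finset.univ.filter fun v => (∃ u ∈ L₁, G.Adj u v) ∧ v ≠ r, by simp⟩
  obtain ⟨L₃, hL₃⟩ : ∃ L : Finset V, ∀ v, v ∈ L ↔ (∃ u ∈ L₂, G.Adj u v) ∧ v ∉ L₁ :=
    ⟨Finset.univ.filter fun v => (∃ u ∈ L₂, G.Adj u v) ∧ v ∉ L₁, by simp⟩
  obtain ⟨L₄, hL₄⟩ : ∃ L : Finset V, ∀ v, v ∈ L ↔ (∃ u ∈ L₃, G.Adj u v) ∧ v ∉ L₂ :=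
    ⟨Finset.univ.filter fun v => (∃ u ∈ L₃, G.Adj u v) ∧ v ∉ L₂, by simp⟩
  have hc {u v : V} (h : G.Adj u v) : c v = c u + 1 := by
    have := c.valid h
    revert this
    generalize c u = x
    generalize c v = y
    revert x y
    decide
  have c₁ : ∀ v ∈ L₁, c v = c r + 1 := fun v hv => hc ((hL₁ v).1 hv)
  have two : ∀ x : Fin 2, x + 1 + 1 = x := by decide
  have one : ∀ x : Fin 2, x ≠ x + 1 := by decide
  have c₂ : ∀ v ∈ L₂, c v = c r := fun v hv => by
    obtain ⟨⟨u, hu, e⟩, -⟩ := (hL₂ v).1 hv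
    rw [hc e, c₁ u hu, two]
  have c₃ : ∀ v ∈ L₃, c v = c r + 1 := fun v hv => by
    obtain ⟨⟨u, hu, e⟩, -⟩ := (hL₃ v).1 hv
    rw [hc e, c₂ u hu]
  have c₄ : ∀ v ∈ L₄, c v = c r := fun v hv => by
    obtain ⟨⟨u, hu, e⟩, -⟩ := (hL₄ v).1 hv
    rw [hc e, c₃ u hu, two]
  have d₁₂ : Disjoint L₁ L₂ := Finset.disjoint_left.2 fun v h h' =>
    one _ ((c₂ v h').symm.trans (c₁ v h))
  have d₂₃ : Disjoint L₂ L₃ := Finset.disjoint_left.2 fun v h h' =>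
    one _ ((c₂ v h).symm.trans (c₃ v h'))
  have d₃₄ : Disjoint L₃ L₄ := Finset.disjoint_left.2 fun v h h' =>
    one _ ((c₄ v h').symm.trans (c₃ v h))
  have hr₂ : r ∉ L₂ := fun h => ((hL₂ r).1 h).2 rfl
  have hr₄ : r ∉ L₄ := fun h => by
    obtain ⟨⟨u, hu, e⟩, -⟩ := (hL₄ r).1 h
    exact ((hL₃ u).1 hu).2 ((hL₁ u).2 e.symm)
  have hpar : ∀ v, ∃ p, v ∈ L₃ → p ∈ L₂ ∧ G.Adj p v := fun v => by
    by_cases hv : v ∈ L₃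
    · obtain ⟨⟨u, hu⟩, -⟩ := (hL₃ v).1 hv
      exact ⟨u, fun _ => hu⟩
    · exact ⟨v, fun h => absurd h hv⟩
  have hgpar : ∀ v, ∃ p, v ∈ L₂ → p ∈ L₁ ∧ G.Adj p v := fun v => by
    by_cases hv : v ∈ L₂
    · obtain ⟨⟨u, hu⟩, -⟩ := (hL₂ v).1 hv
      exact ⟨u, fun _ => hu⟩
    · exact ⟨v, fun h => absurd h hv⟩
  choose par hpar using hpar
  choose gpar hgpar using hgpar
  -- More edges between consecutive levels would leave a core of degrees above four, whose upper
  -- side hangs from `r` by paths of length 1, 2 or 3.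
  have s₁₂ : ∑ x ∈ L₁, (L₂.filter (G.Adj x)).card ≤ 4 * (L₁.card + L₂.card) := by
    by_contra! hlt
    obtain ⟨X, hX, Y, hY, hne, hd⟩ := exists_fourLtDegreesBetween d₁₂ hlt
    exact hd.false_of_common_parent hG h8 hne (p := r) (fun x hx => (hL₁ x).1 (hX hx))
      fun h => hr₂ (hY h)
  have s₂₃ : ∑ x ∈ L₂, (L₃.filter (G.Adj x)).card ≤ 4 * (L₂.card + L₃.card) := by
    by_contra! hlt
    obtain ⟨X, hX, Y, hY, hne, hd⟩ := exists_fourLtDegreesBetween d₂₃ hlt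
    exact hd.false_of_common_grandparent hG h8 hne (par := gpar) (g := r)
      (fun x hx => (hgpar x (hX hx)).2) (fun x hx => (hL₁ _).1 (hgpar x (hX hx)).1)
      (fun x hx h => ((hL₃ _).1 (hY h)).2 (hgpar x (hX hx)).1) fun h => hr₂ (hX h)
  have s₃₄ : ∑ x ∈ L₃, (L₄.filter (G.Adj x)).card ≤ 4 * (L₃.card + L₄.card) := by
    by_contra! hlt
    obtain ⟨X, hX, Y, hY, hne, hd⟩ := exists_fourLtDegreesBetween d₃₄ hlt
    have hp {x : V} (hx : x ∈ X) := hpar x (hX hx)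
    have hg {x : V} (hx : x ∈ X) := hgpar _ (hp hx).1
    exact hd.false_of_common_root hG h8 hne (par := par) (gpar := gpar) (r := r)
      (fun x hx => (hp hx).2) (fun x hx => (hg hx).2) (fun x hx => (hL₁ _).1 (hg hx).1)
      (fun x hx h => ((hL₄ _).1 (hY h)).2 (hp hx).1)
      (fun x hx h => ((hL₃ _).1 (hX h)).2 (hg hx).1)
      (fun x hx h => hr₂ (h ▸ (hp hx).1)) fun h => hr₄ (hY h)
  have hdc (X Y : Finset V) :
      ∑ y ∈ Y, (X.filter (G.Adj y)).card = ∑ x ∈ X, (Y.filter (G.Adj x)).card := by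
    have := Finset.sum_card_bipartiteAbove_eq_sum_card_bipartiteBelow G.Adj (s := X) (t := Y)
    simp only [Finset.bipartiteAbove, Finset.bipartiteBelow] at this
    rw [this]
    simp only [G.adj_comm]
  have hdegsum (A X B : Finset V) (h : ∀ x ∈ X, ∀ y, G.Adj x y → y ∈ A ∨ y ∈ B) :
      K * X.card ≤ ∑ x ∈ X, (A.filter (G.Adj x)).card + ∑ x ∈ X, (B.filter (G.Adj x)).card := by
    rw [← Finset.sum_add_distrib, mul_comm, ← smul_eq_mul, ← Finset.sum_const]
    refine Finset.sum_le_sum fun x hx => (hdeg x).trans ?_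
    refine le_trans (Finset.card_le_card fun y hy => ?_) (Finset.card_union_le _ _)
    rw [mem_neighborFinset] at hy
    rw [← Finset.filter_union, Finset.mem_filter, Finset.mem_union]
    exact ⟨h x hx y hy, hy⟩
  have k₁ := hdegsum {r} L₁ L₂ fun x hx y e => by
    by_cases hy : y = r
    · exact Or.inl (by simp [hy])
    · exact Or.inr ((hL₂ y).2 ⟨⟨x, hx, e⟩, hy⟩)
  have k₂ := hdegsum L₁ L₂ L₃ fun x hx y e => by
    by_cases hy : y ∈ L₁
    · exact Or.inl hy
    · exact Or.inr ((hL₃ y).2 ⟨⟨x, hx, e⟩, hy⟩)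
  have k₃ := hdegsum L₂ L₃ L₄ fun x hx y e => by
    by_cases hy : y ∈ L₂
    · exact Or.inl hy
    · exact Or.inr ((hL₄ y).2 ⟨⟨x, hx, e⟩, hy⟩)
  rw [hdc L₁ L₂] at k₂
  rw [hdc L₂ L₃] at k₃
  have s₀₁ : ∑ x ∈ L₁, (({r} : Finset V).filter (G.Adj x)).card ≤ L₁.card := by
    refine (Finset.sum_le_card_nsmul _ _ 1 fun x _ => ?_).trans (by simp)
    exact (Finset.card_filter_le _ _).trans (by simp)
  have k₀ : K ≤ L₁.card := (hdeg r).trans (Finset.card_le_card fun y hy =>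
    (hL₁ y).2 ((mem_neighborFinset _ _ _).1 hy))
  have hn : L₄.card ≤ Fintype.card V := Finset.card_le_univ _
  -- The degree sums give $(K-12)|L_i| \le 4|L_{i+1}|$ once $|L_{i-1}| \le |L_i|$. As $K \ge 24$,
  -- $K-12 \ge K/2$, which gives growth by $K/8$.
  have g₁ : K * L₁.card ≤ 8 * L₂.card := by nlinarith
  have m₁ : L₁.card ≤ L₂.card := by nlinarith
  have g₂ : K * L₂.card ≤ 8 * L₃.card := by nlinarith
  have m₂ : L₂.card ≤ L₃.card := by nlinarith
  have g₃ : K * L₃.card ≤ 8 * L₄.card := by nlinarith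
  calc K ^ 4 = K ^ 3 * K := by ring
    _ ≤ K ^ 3 * L₁.card := Nat.mul_le_mul_left _ k₀
    _ = K ^ 2 * (K * L₁.card) := by ring
    _ ≤ K ^ 2 * (8 * L₂.card) := Nat.mul_le_mul_left _ g₁
    _ = 8 * K * (K * L₂.card) := by ring
    _ ≤ 8 * K * (8 * L₃.card) := Nat.mul_le_mul_left _ g₂
    _ = 64 * (K * L₃.card) := by ring
    _ ≤ 64 * (8 * L₄.card) := Nat.mul_le_mul_left _ g₃
    _ ≤ 512 * Fintype.card V := by omega

open scoped Classical in
/-- The degree sum of a bipartite graph without eight-cycles is at most `2 K n` as soon as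
`K ≥ 24` and `K⁴ > 512 n`. -/
theorem sum_degree_le_of_cycleGraph_eight_free {V : Type*} [Fintype V] {G : SimpleGraph V}
    (hG : G.IsBipartite) (h8 : (cycleGraph 8).Free G) {K : ℕ} (hK : 24 ≤ K)
    (hn : 512 * Fintype.card V < K ^ 4) : ∑ v, G.degree v ≤ 2 * K * Fintype.card V := by
  by_contra! hlt
  obtain ⟨T, -, ⟨t, ht⟩, hT⟩ := Finset.exists_subset_forall_lt_card_rel
    (fun u v (h : G.Adj u v) => h.symm) K Finset.univ (by
      simpa [← card_neighborFinset_eq_degree, neighborFinset_eq_filter] using hlt)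
  have : Nonempty (T : Set V) := ⟨⟨t, ht⟩⟩
  have hbip : (G.induce (T : Set V)).IsBipartite := by
    obtain ⟨c⟩ := hG
    exact ⟨c.comp (Embedding.induce (T : Set V)).toHom⟩
  have hfree : (cycleGraph 8).Free (G.induce (T : Set V)) := fun ⟨f⟩ =>
    h8 ⟨(Copy.induce G (T : Set V)).comp f⟩
  have := pow_four_le_of_le_degree hbip hfree hK fun v => by
    refine (hT v v.2).le.trans ?_
    rw [← card_neighborFinset_eq_degree, ← Finset.card_map (Function.Embedding.subtype _)]
    refine Finset.card_le_card fun w hw => ?_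
    rw [Finset.mem_filter] at hw
    simpa using hw.symm
  have hc : Fintype.card (T : Set V) ≤ Fintype.card V := Fintype.card_subtype_le _
  omega

end SimpleGraph

/-! ### Fat and thin diagonals of a hexagon. -/

namespace SimpleGraph

variable {V : Type*} {G : SimpleGraph V}

/-- Two vertices with at least four common neighbours: there is a common neighbour avoiding any
three prescribed vertices. -/
def Fat (G : SimpleGraph V) (u v : V) : Prop :=
  ∀ a b c, ∃ w, G.Adj u w ∧ G.Adj w v ∧ w ≠ a ∧ w ≠ b ∧ w ≠ c

theorem Fat.symm {u v : V} (h : G.Fat u v) : G.Fat v u := fun a b c => by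
  obtain ⟨w, h₁, h₂, h₃⟩ := h a b c
  exact ⟨w, h₂.symm, h₁.symm, h₃⟩

theorem exists_triple_of_not_fat {u v : V} (h : ¬ G.Fat u v) :
    ∃ a b c, ∀ w, G.Adj u w → G.Adj w v → w = a ∨ w = b ∨ w = c := by
  unfold Fat at h
  push Not at h
  obtain ⟨a, b, c, h⟩ := h
  refine ⟨a, b, c, fun w h₁ h₂ => ?_⟩
  have := h w h₁ h₂
  tauto

/-- A labelled hexagon of a graph. -/
structure IsHexagon (G : SimpleGraph V) (f : Fin 6 → V) : Prop where
  injective : Function.Injective f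
  adj : ∀ i, G.Adj (f i) (f (i + 1))

theorem IsHexagon.rotate {f : Fin 6 → V} (hf : G.IsHexagon f) (k : Fin 6) :
    G.IsHexagon fun i => f (i + k) :=
  ⟨fun i j h => add_right_cancel (hf.injective h), fun i => by
    have := hf.adj (i + k)
    rwa [add_right_comm] at this⟩

section EightFree

variable (hG : G.IsBipartite) (h8 : (cycleGraph 8).Free G)
include hG h8

/-- The eight-cycle is $p\,u\,q\,u'\,t\,s'\,w\,s$. Both `w` and `u'` must avoid three vertices,
which is why fatness asks for four common neighbours. -/
theorem false_of_three_fat {p q t s s' : V} (hps : G.Adj p s) (hst : G.Adj s' t)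
    (hpq : G.Fat p q) (hqt : G.Fat q t) (hss : G.Fat s s') (npq : p ≠ q) (nqt : q ≠ t)
    (npt : p ≠ t) (nss : s ≠ s') : False := by
  obtain ⟨w, e₁, e₂, w₁, w₂, w₃⟩ := hss p q t
  obtain ⟨u, e₃, e₄, u₁, u₂, -⟩ := hpq s s' s
  obtain ⟨u', e₅, e₆, u₃, u₄, u₅⟩ := hqt s s' u
  exact false_of_eight_cycle hG h8 e₃ e₄ e₅ e₆ hst.symm e₂.symm e₁.symm hps.symm
    npq npt w₁.symm nqt w₂.symm w₃.symm u₅.symm u₂ u₁ u₄ u₃ nss.symm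

/-- The eight-cycle is $x\,s\,w\,t\,y\,t'\,w'\,s'$. -/
theorem false_of_two_fat {x y s t s' t' : V} (hsx : G.Adj s x) (hty : G.Adj t y)
    (hsx' : G.Adj s' x) (hty' : G.Adj t' y) (hst : G.Fat s t) (hst' : G.Fat s' t')
    (nxy : x ≠ y) (n₁ : s ≠ t) (n₂ : s ≠ s') (n₃ : s ≠ t') (n₄ : t ≠ s') (n₅ : t ≠ t')
    (n₆ : s' ≠ t') : False := by
  obtain ⟨w, e₁, e₂, w₁, w₂, -⟩ := hst x y x
  obtain ⟨w', e₃, e₄, w₃, w₄, w₅⟩ := hst' x y w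
  exact false_of_eight_cycle hG h8 hsx.symm e₁ e₂ hty hty'.symm e₄.symm e₃.symm hsx'
    w₁.symm nxy w₃.symm w₂ w₅.symm w₄.symm n₁ n₃ n₂ n₅ n₄ n₆.symm

/-- A fat triangle whose sides are spanned by three prescribed vertices is unique up to the
order of its vertices. -/
theorem mem_of_fat_triangles {x y a b c a' b' c' : V} (nxy : x ≠ y)
    (h₁ : G.Adj a x) (h₂ : G.Adj b x) (h₃ : G.Adj b y) (h₄ : G.Adj c y)
    (h₁' : G.Adj a' x) (h₂' : G.Adj b' x) (h₃' : G.Adj b' y) (h₄' : G.Adj c' y)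
    (fab : G.Fat a b) (fbc : G.Fat b c) (fac : G.Fat a c)
    (fab' : G.Fat a' b') (fbc' : G.Fat b' c') (fac' : G.Fat a' c')
    (nab : a ≠ b) (nbc : b ≠ c) (nac : a ≠ c) (nab' : a' ≠ b') (nbc' : b' ≠ c')
    (nac' : a' ≠ c') :
    (a = a' ∨ a = b' ∨ a = c') ∧ (b = a' ∨ b = b' ∨ b = c') ∧ (c = a' ∨ c = b' ∨ c = c') := by
  have key {s t s' t' : V} (hsx : G.Adj s x) (hty : G.Adj t y)
    (hsx' : G.Adj s' x) (hty' : G.Adj t' y) (hst : G.Fat s t) (hst' : G.Fat s' t')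
    (n₁ : s ≠ t) (n₆ : s' ≠ t') : s = s' ∨ s = t' ∨ t = s' ∨ t = t' := by
    by_contra! h
    exact false_of_two_fat hG h8 hsx hty hsx' hty' hst hst' nxy n₁ h.1 h.2.1 h.2.2.1 h.2.2.2 n₆
  -- Every side of one triangle meets every side of the other. A pair meeting all three sides of a
  -- triangle contains two of its vertices, so no vertex of either triangle lies outside the other.
  have k₁ := key h₁ h₃ h₁' h₃' fab fab' nab nab'
  have k₂ := key h₁ h₃ h₁' h₄' fab fac' nab nac'
  have k₃ := key h₁ h₃ h₂' h₄' fab fbc' nab nbc'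
  have k₄ := key h₁ h₄ h₁' h₃' fac fab' nac nab'
  have k₅ := key h₁ h₄ h₁' h₄' fac fac' nac nac'
  have k₆ := key h₁ h₄ h₂' h₄' fac fbc' nac nbc'
  have k₇ := key h₂ h₄ h₁' h₃' fbc fab' nbc nab'
  have k₈ := key h₂ h₄ h₁' h₄' fbc fac' nbc nac'
  have k₉ := key h₂ h₄ h₂' h₄' fbc fbc' nbc nbc'
  clear key
  refine ⟨?_, ?_, ?_⟩ <;> by_contra! h <;> grind

/-- If each pair of opposite diagonals contains a fat one, choose one from each pair. The three
chosen are either consecutive, which `false_of_three_fat` excludes, or form one of the two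
triangles. -/
theorem IsHexagon.fat_cases {f : Fin 6 → V} (hf : G.IsHexagon f) :
    (G.Fat (f 0) (f 2) ∧ G.Fat (f 2) (f 4) ∧ G.Fat (f 4) (f 0)) ∨
    (G.Fat (f 1) (f 3) ∧ G.Fat (f 3) (f 5) ∧ G.Fat (f 5) (f 1)) ∨
    (¬ G.Fat (f 0) (f 2) ∧ ¬ G.Fat (f 3) (f 5)) ∨
    (¬ G.Fat (f 1) (f 3) ∧ ¬ G.Fat (f 4) (f 0)) ∨
    (¬ G.Fat (f 2) (f 4) ∧ ¬ G.Fat (f 5) (f 1)) := by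
  have key (i₀ i₁ i₂ i₃ i₄ : Fin 6) (h : i₁ = i₀ + 1 ∧ i₂ = i₀ + 2 ∧ i₃ = i₀ + 3 ∧ i₄ = i₃ + 1)
      (h₀ : G.Fat (f i₀) (f i₂)) (h₁ : G.Fat (f i₁) (f i₃)) (h₂ : G.Fat (f i₂) (f i₄)) :
      False := by
    obtain ⟨rfl, rfl, rfl, rfl⟩ := h
    refine false_of_three_fat hG h8 (hf.adj i₀) (hf.adj (i₀ + 3)) h₀ h₂ h₁ ?_ ?_ ?_ ?_ <;>
      refine hf.injective.ne ?_ <;> clear h₀ h₁ h₂ <;> revert i₀ <;> decide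
  have k₀ := key 0 1 2 3 4 (by decide)
  have k₁ := key 1 2 3 4 5 (by decide)
  have k₂ := key 2 3 4 5 0 (by decide)
  have k₃ := key 3 4 5 0 1 (by decide)
  have k₄ := key 4 5 0 1 2 (by decide)
  have k₅ := key 5 0 1 2 3 (by decide)
  clear key
  grind

end EightFree

/-! ### Counting labelled hexagons. -/

section Counting

variable [Fintype V]

-- Once `f 1`, `f 3`, `f 5` are fixed, the fat triangle is determined as a set, leaving its six
-- orderings.
open scoped Classical in
theorem card_hexagon_fat_le (hG : G.IsBipartite) (h8 : (cycleGraph 8).Free G) :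
    (Finset.univ.filter fun f : Fin 6 → V => G.IsHexagon f ∧
      G.Fat (f 0) (f 2) ∧ G.Fat (f 2) (f 4) ∧ G.Fat (f 4) (f 0)).card ≤
      6 * Fintype.card V ^ 3 := by
  refine (Finset.card_le_mul_card_image (f := fun f => (f 1, f 3, f 5)) _ 6 ?_).trans
    (Nat.mul_le_mul_left 6 ((Finset.card_le_univ _).trans (by simp [pow_succ, mul_assoc])))
  intro t ht
  obtain ⟨g, hg, rfl⟩ := Finset.mem_image.1 ht
  simp only [Finset.mem_filter, Finset.mem_univ, true_and] at hg
  obtain ⟨hg, g₁, g₂, g₃⟩ := hg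
  refine (Finset.card_le_card_of_injOn (fun f => (f 0, f 2, f 4))
    (t := {(g 0, g 2, g 4), (g 0, g 4, g 2), (g 2, g 0, g 4), (g 2, g 4, g 0), (g 4, g 0, g 2),
      (g 4, g 2, g 0)}) ?_ ?_).trans Finset.card_le_six
  · intro f hf
    simp only [Finset.coe_filter, Finset.mem_filter, Finset.mem_univ, true_and, Set.mem_ofPred_eq,
      Prod.mk.injEq] at hf
    obtain ⟨⟨hf, f₁, f₂, f₃⟩, e₁, e₃, e₅⟩ := hf
    have hm := mem_of_fat_triangles hG h8 (x := g 1) (y := g 3)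
      (hg.injective.ne (by decide)) (e₁ ▸ hf.adj 0) (e₁ ▸ (hf.adj 1).symm)
      (e₃ ▸ hf.adj 2) (e₃ ▸ (hf.adj 3).symm) (hg.adj 0) (hg.adj 1).symm (hg.adj 2)
      (hg.adj 3).symm f₁ f₂ f₃.symm g₁ g₂ g₃.symm (hf.injective.ne (by decide))
      (hf.injective.ne (by decide)) (hf.injective.ne (by decide)) (hg.injective.ne (by decide))
      (hg.injective.ne (by decide)) (hg.injective.ne (by decide))
    have n₁ : f 0 ≠ f 2 := hf.injective.ne (by decide)
    have n₂ : f 2 ≠ f 4 := hf.injective.ne (by decide)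
    have n₃ : f 0 ≠ f 4 := hf.injective.ne (by decide)
    simp only [Finset.coe_insert, Finset.coe_singleton, Set.mem_insert_iff,
      Set.mem_singleton_iff, Prod.mk.injEq]
    change (f 0 = g 0 ∨ f 0 = g 2 ∨ f 0 = g 4) ∧ (f 2 = g 0 ∨ f 2 = g 2 ∨ f 2 = g 4) ∧
      (f 4 = g 0 ∨ f 4 = g 2 ∨ f 4 = g 4) at hm
    grind
  · intro f hf f' hf' h
    simp only [Finset.coe_filter, Finset.mem_filter, Finset.mem_univ, true_and, Set.mem_ofPred_eq,
      Prod.mk.injEq] at hf hf' h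
    funext i
    fin_cases i
    · exact h.1
    · exact hf.2.1.trans hf'.2.1.symm
    · exact h.2.1
    · exact hf.2.2.1.trans hf'.2.2.1.symm
    · exact h.2.2
    · exact hf.2.2.2.trans hf'.2.2.2.symm

-- The darts `(f 2, f 3)` and `(f 5, f 0)` are free; `f 1` and `f 4` are then common neighbours of
-- thin pairs, with at most three choices each.
open scoped Classical in
theorem card_hexagon_thin_le :
    (Finset.univ.filter fun f : Fin 6 → V => G.IsHexagon f ∧
      ¬ G.Fat (f 0) (f 2) ∧ ¬ G.Fat (f 3) (f 5)).card ≤ 9 * (∑ v, G.degree v) ^ 2 := by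
  let D : Finset (V × V) := Finset.univ.filter fun p => G.Adj p.1 p.2
  have hD : D.card = ∑ v, G.degree v := by
    simp only [D, Finset.card_filter, Fintype.sum_prod_type, ← card_neighborFinset_eq_degree,
      neighborFinset_eq_filter]
  refine (Finset.card_le_mul_card_image (f := fun f => ((f 2, f 3), (f 5, f 0))) _ 9 ?_).trans
    (Nat.mul_le_mul_left 9 ?_)
  · intro t ht
    obtain ⟨g, hg, rfl⟩ := Finset.mem_image.1 ht
    simp only [Finset.mem_filter, Finset.mem_univ, true_and] at hg
    obtain ⟨hg, g₁, g₂⟩ := hg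
    obtain ⟨a, b, c, habc⟩ := exists_triple_of_not_fat g₁
    obtain ⟨a', b', c', habc'⟩ := exists_triple_of_not_fat g₂
    refine (Finset.card_le_card_of_injOn (fun f => (f 1, f 4))
      (t := ({a, b, c} : Finset V) ×ˢ ({a', b', c'} : Finset V)) ?_ ?_).trans ?_
    · intro f hf
      simp only [Finset.coe_filter, Finset.mem_filter, Finset.mem_univ, true_and,
        Set.mem_ofPred_eq, Prod.mk.injEq] at hf
      obtain ⟨⟨hf, -, -⟩, ⟨e₂, e₃⟩, e₅, e₀⟩ := hf
      rw [← e₂, ← e₀] at habc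
      rw [← e₃, ← e₅] at habc'
      simpa using ⟨habc _ (hf.adj 0) (hf.adj 1), habc' _ (hf.adj 3) (hf.adj 4)⟩
    · intro f hf f' hf' h
      simp only [Finset.coe_filter, Finset.mem_filter, Finset.mem_univ, true_and,
        Set.mem_ofPred_eq, Prod.mk.injEq] at hf hf' h
      funext i
      fin_cases i
      · exact hf.2.2.2.trans hf'.2.2.2.symm
      · exact h.1
      · exact hf.2.1.1.trans hf'.2.1.1.symm
      · exact hf.2.1.2.trans hf'.2.1.2.symm
      · exact h.2
      · exact hf.2.2.1.trans hf'.2.2.1.symm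
    · rw [Finset.card_product]
      exact Nat.mul_le_mul Finset.card_le_three Finset.card_le_three
  · rw [← hD, sq, ← Finset.card_product]
    refine Finset.card_le_card fun t ht => ?_
    obtain ⟨g, hg, rfl⟩ := Finset.mem_image.1 ht
    simp only [Finset.mem_filter, Finset.mem_univ, true_and] at hg
    simpa [D] using ⟨hg.1.adj 2, hg.1.adj 5⟩

open scoped Classical in
theorem card_hexagon_rotate_le (P Q : (Fin 6 → V) → Prop) (k : Fin 6)
    (h : ∀ f, P f → Q fun i => f (i + k)) :
    (Finset.univ.filter fun f : Fin 6 → V => G.IsHexagon f ∧ P f).card ≤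
      (Finset.univ.filter fun f : Fin 6 → V => G.IsHexagon f ∧ Q f).card := by
  refine Finset.card_le_card_of_injOn (fun f i => f (i + k)) ?_ ?_
  · intro f hf
    simp only [Finset.coe_filter, Finset.mem_univ, true_and, Set.mem_ofPred_eq] at hf ⊢
    exact ⟨hf.1.rotate k, h f hf.2⟩
  · intro f _ f' _ hff
    funext i
    have := congrFun hff (i - k)
    simpa using this

theorem labelledCopyCount_eq_natCard {W : Type*} [Fintype W] (H : SimpleGraph W) :
    G.labelledCopyCount H = Nat.card (Copy H G) := by
  classical rw [labelledCopyCount, Nat.card_eq_fintype_card]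

-- Rotation reduces the five cases to one fat and one thin count: $2 \cdot 6 = 12$ and $3 \cdot 9 =
-- 27$.
open scoped Classical in
theorem labelledCopyCount_cycleGraph_six_le (hG : G.IsBipartite)
    (h8 : (cycleGraph 8).Free G) :
    G.labelledCopyCount (cycleGraph 6) ≤
      12 * Fintype.card V ^ 3 + 27 * (∑ v, G.degree v) ^ 2 := by
  have hle : G.labelledCopyCount (cycleGraph 6) ≤
      (Finset.univ.filter fun f : Fin 6 → V => G.IsHexagon f).card := by
    have hadj : ∀ i : Fin 6, (cycleGraph 6).Adj i (i + 1) := by decide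
    rw [labelledCopyCount_eq_natCard, ← Fintype.card_subtype, ← Nat.card_eq_fintype_card]
    exact Nat.card_le_card_of_injective
      (fun f : Copy (cycleGraph 6) G => (⟨f, f.injective, fun i => f.toHom.map_adj (hadj i)⟩ :
        {f : Fin 6 → V // G.IsHexagon f}))
      fun f g h => DFunLike.coe_injective (congrArg Subtype.val h)
  let F₁ := Finset.univ.filter fun f : Fin 6 → V => G.IsHexagon f ∧
    G.Fat (f 0) (f 2) ∧ G.Fat (f 2) (f 4) ∧ G.Fat (f 4) (f 0)
  let F₂ := Finset.univ.filter fun f : Fin 6 → V => G.IsHexagon f ∧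
    G.Fat (f 1) (f 3) ∧ G.Fat (f 3) (f 5) ∧ G.Fat (f 5) (f 1)
  let T₁ := Finset.univ.filter fun f : Fin 6 → V => G.IsHexagon f ∧
    ¬ G.Fat (f 0) (f 2) ∧ ¬ G.Fat (f 3) (f 5)
  let T₂ := Finset.univ.filter fun f : Fin 6 → V => G.IsHexagon f ∧
    ¬ G.Fat (f 1) (f 3) ∧ ¬ G.Fat (f 4) (f 0)
  let T₃ := Finset.univ.filter fun f : Fin 6 → V => G.IsHexagon f ∧
    ¬ G.Fat (f 2) (f 4) ∧ ¬ G.Fat (f 5) (f 1)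
  have hcover : (Finset.univ.filter fun f : Fin 6 → V => G.IsHexagon f) ⊆
      F₁ ∪ (F₂ ∪ (T₁ ∪ (T₂ ∪ T₃))) := by
    intro f hf
    simp only [Finset.mem_filter, Finset.mem_univ, true_and] at hf
    simp only [F₁, F₂, T₁, T₂, T₃, Finset.mem_union, Finset.mem_filter, Finset.mem_univ, true_and]
    exact (hf.fat_cases hG h8).imp (⟨hf, ·⟩) (.imp (⟨hf, ·⟩) (.imp (⟨hf, ·⟩)
      (.imp (⟨hf, ·⟩) (⟨hf, ·⟩))))
  have hF₁ : F₁.card ≤ _ := card_hexagon_fat_le hG h8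
  have hF₂ : F₂.card ≤ F₁.card := by
    convert! card_hexagon_rotate_le (G := G)
      (fun f => G.Fat (f 1) (f 3) ∧ G.Fat (f 3) (f 5) ∧ G.Fat (f 5) (f 1))
      (fun f => G.Fat (f 0) (f 2) ∧ G.Fat (f 2) (f 4) ∧ G.Fat (f 4) (f 0)) 1 fun f h => h
  have hT₁ : T₁.card ≤ _ := card_hexagon_thin_le
  have hT₂ : T₂.card ≤ T₁.card := by
    convert! card_hexagon_rotate_le (G := G)
      (fun f => ¬ G.Fat (f 1) (f 3) ∧ ¬ G.Fat (f 4) (f 0))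
      (fun f => ¬ G.Fat (f 0) (f 2) ∧ ¬ G.Fat (f 3) (f 5)) 1 fun f h => h
  have hT₃ : T₃.card ≤ T₁.card := by
    convert! card_hexagon_rotate_le (G := G)
      (fun f => ¬ G.Fat (f 2) (f 4) ∧ ¬ G.Fat (f 5) (f 1))
      (fun f => ¬ G.Fat (f 0) (f 2) ∧ ¬ G.Fat (f 3) (f 5)) 2 fun f h => h
  have h₀ := Finset.card_le_card hcover
  have h₁ := Finset.card_union_le F₁ (F₂ ∪ (T₁ ∪ (T₂ ∪ T₃)))
  have h₂ := Finset.card_union_le F₂ (T₁ ∪ (T₂ ∪ T₃))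
  have h₃ := Finset.card_union_le T₁ (T₂ ∪ T₃)
  have h₄ := Finset.card_union_le T₂ T₃
  omega

end Counting

end SimpleGraph

/-! ### The extremal example $K_{3,n-3}$. -/

namespace SimpleGraph

/-- The complete bipartite graph on `Fin n` with the first three vertices on one side. -/
def threeVersusRest (n : ℕ) : SimpleGraph (Fin n) where
  Adj i j := ¬ (i.val < 3 ↔ j.val < 3)
  symm := ⟨fun i j h => by tauto⟩
  loopless := ⟨fun i h => h Iff.rfl⟩

theorem threeVersusRest_isBipartite (n : ℕ) : (threeVersusRest n).IsBipartite := by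
  classical
  refine ⟨Coloring.mk (fun i => if i.val < 3 then 0 else 1) ?_⟩
  intro i j h
  change ¬ (i.val < 3 ↔ j.val < 3) at h
  split_ifs <;> first | decide | tauto

/-- An eight-cycle alternates between the sides, so four distinct vertices would lie among the first
three. -/
theorem threeVersusRest_free (n : ℕ) : (cycleGraph 8).Free (threeVersusRest n) := by
  have two {p q r : Prop} (h : ¬ (p ↔ q)) (h' : ¬ (q ↔ r)) : p ↔ r := by tauto
  have one {p q : Prop} (h : ¬ (p ↔ q)) (h' : ¬ p) : q := by tauto
  rintro ⟨f⟩
  have hadj (i j : Fin 8) (h : (cycleGraph 8).Adj i j) : ¬ ((f i).val < 3 ↔ (f j).val < 3) :=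
    f.toHom.map_adj h
  have hne (i j : Fin 8) (h : i ≠ j) : (f i).val ≠ (f j).val := fun h' =>
    h (f.injective (Fin.ext h'))
  have a₀ := hadj 0 1 (by decide)
  have a₁ := hadj 1 2 (by decide)
  have a₂ := hadj 2 3 (by decide)
  have a₃ := hadj 3 4 (by decide)
  have a₄ := hadj 4 5 (by decide)
  have a₅ := hadj 5 6 (by decide)
  have a₆ := hadj 6 7 (by decide)
  have n₁ := hne 0 2 (by decide)
  have n₂ := hne 0 4 (by decide)
  have n₃ := hne 0 6 (by decide)
  have n₄ := hne 2 4 (by decide)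
  have n₅ := hne 2 6 (by decide)
  have n₆ := hne 4 6 (by decide)
  have m₁ := hne 1 3 (by decide)
  have m₂ := hne 1 5 (by decide)
  have m₃ := hne 1 7 (by decide)
  have m₄ := hne 3 5 (by decide)
  have m₅ := hne 3 7 (by decide)
  have m₆ := hne 5 7 (by decide)
  by_cases h : (f 0).val < 3
  · have h₂ := (two a₀ a₁).1 h
    have h₄ := (two a₂ a₃).1 h₂
    have h₆ := (two a₄ a₅).1 h₄
    clear a₀ a₁ a₂ a₃ a₄ a₅ a₆ m₁ m₂ m₃ m₄ m₅ m₆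
    omega
  · have h₁ := one a₀ h
    have h₃ := (two a₁ a₂).1 h₁
    have h₅ := (two a₃ a₄).1 h₃
    have h₇ := (two a₅ a₆).1 h₅
    clear a₀ a₁ a₂ a₃ a₄ a₅ a₆ n₁ n₂ n₃ n₄ n₅ n₆
    omega

/-- A closed walk of length six alternating between the two sides of `threeVersusRest (m + 3)`. -/
def hexagonOfEmbeddings {m : ℕ} (σ : Fin 3 ↪ Fin 3) (τ : Fin 3 ↪ Fin m) : Fin 6 → Fin (m + 3) :=
  ![(σ 0).castLE (by omega), (τ 0).addNat 3, (σ 1).castLE (by omega), (τ 1).addNat 3,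
    (σ 2).castLE (by omega), (τ 2).addNat 3]

theorem isHexagon_hexagonOfEmbeddings {m : ℕ} (σ : Fin 3 ↪ Fin 3) (τ : Fin 3 ↪ Fin m) :
    (threeVersusRest (m + 3)).IsHexagon (hexagonOfEmbeddings σ τ) := by
  have s₁ : (σ 0).val ≠ (σ 1).val := fun h => by simpa using σ.injective (Fin.ext h)
  have s₂ : (σ 0).val ≠ (σ 2).val := fun h => by simpa using σ.injective (Fin.ext h)
  have s₃ : (σ 1).val ≠ (σ 2).val := fun h => by simpa using σ.injective (Fin.ext h)
  have t₁ : (τ 0).val ≠ (τ 1).val := fun h => by simpa using τ.injective (Fin.ext h)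
  have t₂ : (τ 0).val ≠ (τ 2).val := fun h => by simpa using τ.injective (Fin.ext h)
  have t₃ : (τ 1).val ≠ (τ 2).val := fun h => by simpa using τ.injective (Fin.ext h)
  constructor
  · intro i j h
    have h' := congrArg Fin.val h
    fin_cases i <;> fin_cases j <;> simp [hexagonOfEmbeddings] at h' ⊢ <;> omega
  · intro i
    change ¬ ((hexagonOfEmbeddings σ τ i).val < 3 ↔ (hexagonOfEmbeddings σ τ (i + 1)).val < 3)
    fin_cases i <;> simp [hexagonOfEmbeddings]

theorem IsHexagon.adj_of_cycleGraph_adj {V : Type*} {G : SimpleGraph V} {f : Fin 6 → V}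
    (hf : G.IsHexagon f) {i j : Fin 6} (h : (cycleGraph 6).Adj i j) : G.Adj (f i) (f j) := by
  rw [cycleGraph_adj] at h
  rcases h with h | h
  · rw [sub_eq_iff_eq_add'.1 h]
    exact (hf.adj j).symm
  · rw [sub_eq_iff_eq_add'.1 h]
    exact hf.adj i

theorem le_labelledCopyCount_threeVersusRest (m : ℕ) :
    12 * (m * (m - 1) * (m - 2)) ≤ (threeVersusRest (m + 3)).labelledCopyCount (cycleGraph 6) := by
  classical
  rw [labelledCopyCount_eq_natCard]
  have hcard : Nat.card (Bool × (Fin 3 ↪ Fin 3) × (Fin 3 ↪ Fin m)) =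
      12 * (m * (m - 1) * (m - 2)) := by
    rw [Nat.card_eq_fintype_card, Fintype.card_prod, Fintype.card_prod, Fintype.card_embedding_eq,
      Fintype.card_embedding_eq]
    simp [Nat.descFactorial]
    ring
  rw [← hcard]
  -- The Boolean decides on which side the labelling starts; this doubles the $6 \cdot m(m-1)(m-2)$
  -- choices.
  let F (p : Bool × (Fin 3 ↪ Fin 3) × (Fin 3 ↪ Fin m)) (i : Fin 6) : Fin (m + 3) :=
    hexagonOfEmbeddings p.2.1 p.2.2 (i + if p.1 then 1 else 0)
  have hF (p) : (threeVersusRest (m + 3)).IsHexagon (F p) :=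
    (isHexagon_hexagonOfEmbeddings p.2.1 p.2.2).rotate _
  refine Nat.card_le_card_of_injective (fun p =>
    (⟨⟨F p, fun h => (hF p).adj_of_cycleGraph_adj h⟩, (hF p).injective⟩ :
      Copy (cycleGraph 6) (threeVersusRest (m + 3)))) ?_
  intro p q hpq
  have h (i : Fin 6) : (F p i).val = (F q i).val :=
    congrArg (fun f : Copy (cycleGraph 6) (threeVersusRest (m + 3)) => (f i).val) hpq
  obtain ⟨b, σ, τ⟩ := p
  obtain ⟨b', σ', τ'⟩ := q
  have hb : b = b' := by
    have h₀ := h 0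
    have l₁ := (σ 0).isLt
    have l₂ := (σ' 0).isLt
    cases b <;> cases b' <;> simp [F, hexagonOfEmbeddings] at h₀ ⊢ <;> omega
  subst hb
  have hH (i : Fin 6) : (hexagonOfEmbeddings σ τ i).val = (hexagonOfEmbeddings σ' τ' i).val := by
    have := h (i - if b then 1 else 0)
    simpa only [F, sub_add_cancel] using this
  have hσ : σ = σ' := by
    ext i
    fin_cases i
    · exact hH 0
    · exact hH 2
    · exact hH 4
  have hτ : τ = τ' := by
    ext i
    have h₁ := hH 1
    have h₃ := hH 3
    have h₅ := hH 5
    simp [hexagonOfEmbeddings] at h₁ h₃ h₅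
    fin_cases i <;> simp [h₁, h₃, h₅]
  rw [hσ, hτ]

end SimpleGraph

/-! ### Assembling the bounds and the asymptotics. -/

theorem le_exBip_six_eight (m : ℕ) :
    m * (m - 1) * (m - 2) ≤
      exBip (m + 3) (SimpleGraph.cycleGraph 6) (SimpleGraph.cycleGraph 8) := by
  classical
  have h := SimpleGraph.le_labelledCopyCount_threeVersusRest m
  rw [SimpleGraph.labelledCopyCount_eq_card_aut_mul_copyCount,
    SimpleGraph.card_aut_cycleGraph_six] at h
  refine (Nat.le_of_mul_le_mul_left h (by norm_num)).trans ?_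
  rw [exBip]
  refine Finset.le_sup (f := fun G : SimpleGraph (Fin (m + 3)) =>
    G.copyCount (SimpleGraph.cycleGraph 6)) ?_
  simp only [Finset.mem_filter, Finset.mem_univ, true_and]
  exact ⟨SimpleGraph.threeVersusRest_isBipartite _, SimpleGraph.threeVersusRest_free _⟩

theorem exBip_six_eight_le {n K : ℕ} (hK : 24 ≤ K) (hn : 512 * n < K ^ 4) :
    exBip n (SimpleGraph.cycleGraph 6) (SimpleGraph.cycleGraph 8) ≤ n ^ 3 + 9 * (K * n) ^ 2 := by
  classical
  rw [exBip]
  refine Finset.sup_le fun G hG => ?_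
  simp only [Finset.mem_filter, Finset.mem_univ, true_and] at hG
  have h₁ := SimpleGraph.labelledCopyCount_cycleGraph_six_le hG.1 hG.2
  have h₂ := SimpleGraph.sum_degree_le_of_cycleGraph_eight_free hG.1 hG.2 hK (by simpa using hn)
  rw [SimpleGraph.labelledCopyCount_eq_card_aut_mul_copyCount,
    SimpleGraph.card_aut_cycleGraph_six, Fintype.card_fin] at h₁
  rw [Fintype.card_fin] at h₂
  have h₃ := Nat.pow_le_pow_left h₂ 2
  have h₄ : (2 * K * n) ^ 2 = 4 * (K * n) ^ 2 := by ring
  rw [h₄] at h₃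
  have h₅ : 12 * G.copyCount (SimpleGraph.cycleGraph 6) ≤ 12 * n ^ 3 + 27 * (4 * (K * n) ^ 2) := by
    refine h₁.trans (Nat.add_le_add_left (Nat.mul_le_mul_left _ ?_) _)
    convert h₃
  omega

theorem theorem2p3 :
    (fun n : ℕ =>
        (exBip n (SimpleGraph.cycleGraph 6) (SimpleGraph.cycleGraph 8) : ℝ) - (n : ℝ) ^ 3)
      =O[Filter.atTop] (fun n : ℕ => (n : ℝ) ^ (5 / 2 : ℝ)) := by
  refine Asymptotics.IsBigO.of_bound 8100 ?_
  filter_upwards [Filter.eventually_ge_atTop 5] with n hn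
  have hn₁ : (1 : ℝ) ≤ n := by exact_mod_cast (by omega : 1 ≤ n)
  have hn₀ : (0 : ℝ) ≤ n := by linarith
  set t : ℝ := (n : ℝ) ^ (1 / 4 : ℝ) with ht
  have t₁ : 1 ≤ t := Real.one_le_rpow hn₁ (by norm_num)
  have t₄ : t ^ 4 = n := by
    rw [ht, ← Real.rpow_natCast, ← Real.rpow_mul hn₀]
    norm_num
  have t₁₀ : (n : ℝ) ^ (5 / 2 : ℝ) = t ^ 10 := by
    rw [ht, ← Real.rpow_natCast, ← Real.rpow_mul hn₀]
    norm_num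
  rw [t₁₀, Real.norm_eq_abs, Real.norm_of_nonneg (by positivity), abs_le]
  constructor
  -- Lower bound: writing $n = m+5$ removes truncated subtraction, and the deficit is $O(n^2)$ with
  -- $n^2 = t^8 \le t^{10}$.
  · obtain ⟨m, rfl⟩ : ∃ m, n = m + 2 + 3 := ⟨n - 5, by omega⟩
    have h := le_exBip_six_eight (m + 2)
    have h' : ((m : ℝ) + 2) * (m + 1) * m ≤
        exBip (m + 2 + 3) (SimpleGraph.cycleGraph 6) (SimpleGraph.cycleGraph 8) := by
      have : (m + 2) * (m + 2 - 1) * (m + 2 - 2) = (m + 2) * (m + 1) * m := by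
        congr 1
      rw [this] at h
      exact_mod_cast h
    have h₂ : (((m + 2 + 3 : ℕ) : ℝ)) ^ 2 ≤ t ^ 10 := by
      rw [← t₄, ← pow_mul]
      exact pow_le_pow_right₀ t₁ (by norm_num)
    push_cast at h₂ ⊢
    have hm : (0 : ℝ) ≤ m := Nat.cast_nonneg m
    nlinarith
  -- Upper bound: `K` is of order $n^{1/4}$. The factor 24 ensures $K \ge 24$ and $K^4 \ge 24^4 n >
  -- 512 n$; then $K \le 30t$ gives $9 \cdot 30^2 = 8100$.
  · have h := exBip_six_eight_le (n := n) (K := ⌈(24 : ℝ) * t⌉₊) (by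
      have : (24 : ℝ) ≤ ⌈(24 : ℝ) * t⌉₊ := le_trans (by linarith) (Nat.le_ceil _)
      exact_mod_cast this) (by
      have h₁ : (24 * t) ^ 4 ≤ (⌈(24 : ℝ) * t⌉₊ : ℝ) ^ 4 := by
        gcongr
        exact Nat.le_ceil _
      have h₂ : (512 : ℝ) * n < (⌈(24 : ℝ) * t⌉₊ : ℝ) ^ 4 := by
        refine lt_of_lt_of_le ?_ h₁
        rw [mul_pow, t₄]
        nlinarith
      exact_mod_cast h₂)
    have h' : (exBip n (SimpleGraph.cycleGraph 6) (SimpleGraph.cycleGraph 8) : ℝ) ≤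
        (n : ℝ) ^ 3 + 9 * ((⌈(24 : ℝ) * t⌉₊ : ℝ) * n) ^ 2 := by exact_mod_cast h
    have hc : (⌈(24 : ℝ) * t⌉₊ : ℝ) ≤ 30 * t := by
      have := Nat.ceil_lt_add_one (a := (24 : ℝ) * t) (by positivity)
      linarith
    have h₃ : 9 * ((⌈(24 : ℝ) * t⌉₊ : ℝ) * n) ^ 2 ≤ 8100 * t ^ 10 := by
      calc 9 * ((⌈(24 : ℝ) * t⌉₊ : ℝ) * n) ^ 2 ≤ 9 * ((30 * t) * n) ^ 2 := by gcongr
        _ = 8100 * t ^ 10 := by rw [← t₄]; ring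
    linarith
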